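/- Let $f_1(x)=\frac{1}{1-x+x^2}$ and, for integers $n\ge 1$, let $$L_n(f_1)=\frac1n\sum_{k=0}^{n-1} f_1\!\left(\tfrac kn\right),\qquad R_n(f_1)=\frac1n\sum_{k=1}^{n} f_1\!\left(\tfrac kn\right)$$ be the left and right Riemann sums of $f_1$ on $[0,1]$. Then $L_n(f_1)=R_n(f_1)$ for every $n\ge 1$, and this common value is monotonically increasing in $n$: if $1\le m\le n$, then $L_m(f_1)\le L_n(f_1)$ and $R_m(f_1)\le R_n(f_1)$. -/

import Mathlib

/-- The left Riemann sum `L_n(f) = (1/n) ∑_{k=0}^{n-1} f(k/n)` of `f` on `[0,1]`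
(meaningful for `1 ≤ n`). -/
noncomputable def leftRiemannSum (f : ℝ → ℝ) (n : ℕ) : ℝ :=
  (1 / (n : ℝ)) * ∑ k ∈ Finset.range n, f ((k : ℝ) / (n : ℝ))

/-- The right Riemann sum `R_n(f) = (1/n) ∑_{k=1}^{n} f(k/n)` of `f` on `[0,1]`
(meaningful for `1 ≤ n`). -/
noncomputable def rightRiemannSum (f : ℝ → ℝ) (n : ℕ) : ℝ :=
  (1 / (n : ℝ)) * ∑ k ∈ Finset.Icc 1 n, f ((k : ℝ) / (n : ℝ))

/-- The function `f_b(x) = 1 / (1 - b x + x²)`. -/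
noncomputable def fb (b : ℝ) (x : ℝ) : ℝ := 1 / (1 - b * x + x ^ 2)

/-! Since f_1(0) = f_1(1), the left, right and trapezoidal sums all coincide. Euler–Maclaurin to
fourth order (`abs_leftRiemannSum_sub_le`) gives L_n = ∫f_1 - 1/(6n²) + E_n, where |E_n| ≤
32/(405n⁴). The increment of -1/(6n²) from n to n + 1 exceeds both error bounds together already at
n = 1, so the explicit constant leaves no small cases to check. -/

/-- A function on the half-line that starts at `0` and has nonnegative derivative is nonnegative. -/
theorem nonneg_of_hasDerivAt_nonneg {φ φ' : ℝ → ℝ} (hφ : ∀ x, HasDerivAt φ (φ' x) x)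
    (h0 : φ 0 = 0) (hφ' : ∀ x, 0 ≤ x → 0 ≤ φ' x) {x : ℝ} (hx : 0 ≤ x) : 0 ≤ φ x := by
  have hmono : MonotoneOn φ (Set.Ici 0) := by
    refine monotoneOn_of_deriv_nonneg (convex_Ici 0)
      (fun y _ => (hφ y).continuousAt.continuousWithinAt)
      (fun y _ => (hφ y).differentiableAt.differentiableWithinAt) fun y hy => ?_
    rw [interior_Ici] at hy
    rw [(hφ y).deriv]
    exact hφ' y (le_of_lt hy)
  simpa [h0] using hmono (Set.self_mem_Ici) (Set.mem_Ici.2 hx) hx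

/-- One-sided error bound for the corrected trapezoidal rule on a single cell. -/
theorem corrected_trapezoid_le {F f f₁ f₂ f₃ f₄ : ℝ → ℝ} {M : ℝ}
    (hF : ∀ x, HasDerivAt F (f x) x) (hf : ∀ x, HasDerivAt f (f₁ x) x)
    (hf₁ : ∀ x, HasDerivAt f₁ (f₂ x) x) (hf₂ : ∀ x, HasDerivAt f₂ (f₃ x) x)
    (hf₃ : ∀ x, HasDerivAt f₃ (f₄ x) x) (hM : ∀ x, -M ≤ f₄ x) (a : ℝ) {h : ℝ} (hh : 0 ≤ h) :
    h / 2 * (f a + f (a + h)) - (F (a + h) - F a) - h ^ 2 / 12 * (f₁ (a + h) - f₁ a)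
      ≤ M * h ^ 5 / 720 := by
  have pow_deriv (n : ℕ) (x : ℝ) : HasDerivAt (fun y : ℝ => y ^ n) (n * x ^ (n - 1)) x :=
    hasDerivAt_pow n x
  have sF (x : ℝ) : HasDerivAt (fun y => F (a + y)) (f (a + x)) x := (hF _).comp_const_add a x
  have s0 (x : ℝ) : HasDerivAt (fun y => f (a + y)) (f₁ (a + x)) x := (hf _).comp_const_add a x
  have s1 (x : ℝ) : HasDerivAt (fun y => f₁ (a + y)) (f₂ (a + x)) x := (hf₁ _).comp_const_add a x
  have s2 (x : ℝ) : HasDerivAt (fun y => f₂ (a + y)) (f₃ (a + x)) x := (hf₂ _).comp_const_add a x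
  have s3 (x : ℝ) : HasDerivAt (fun y => f₃ (a + y)) (f₄ (a + x)) x := (hf₃ _).comp_const_add a x
  -- As functions of the step length, `first`, `second` and `third` are successive derivatives, all
  -- vanishing at 0. One more derivative leaves y²/12 · (M + f₄(a + y)) ≥ 0, so nonnegativity
  -- integrates back up.
  have third (x : ℝ) (hx : 0 ≤ x) :
      0 ≤ M * x ^ 3 / 36 - (x / 6 * f₂ (a + x) - 1 / 6 * (f₁ (a + x) - f₁ a)
        - x ^ 2 / 12 * f₃ (a + x)) := by
    refine nonneg_of_hasDerivAt_nonneg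
      (φ := fun y => M * y ^ 3 / 36 - (y / 6 * f₂ (a + y) - 1 / 6 * (f₁ (a + y) - f₁ a)
        - y ^ 2 / 12 * f₃ (a + y)))
      (φ' := fun y => y ^ 2 / 12 * (M + f₄ (a + y)))
      (fun y => ?_) (by simp) (fun y _ => ?_) hx
    · refine HasDerivAt.congr_deriv (((pow_deriv 3 y).const_mul M).div_const 36 |>.sub
        ((((hasDerivAt_id y).div_const 6).mul (s2 y)).sub
          (((s1 y).sub_const (f₁ a)).const_mul (1 / 6)) |>.sub
          (((pow_deriv 2 y).div_const 12).mul (s3 y)))) ?_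
      simp only [id]
      push_cast
      ring
    · exact mul_nonneg (by positivity) (by linarith [hM (a + y)])
  have second (x : ℝ) (hx : 0 ≤ x) :
      0 ≤ M * x ^ 4 / 144 - (1 / 2 * (f a - f (a + x)) + x / 3 * f₁ (a + x) + x / 6 * f₁ a
        - x ^ 2 / 12 * f₂ (a + x)) := by
    refine nonneg_of_hasDerivAt_nonneg
      (φ := fun y => M * y ^ 4 / 144 - (1 / 2 * (f a - f (a + y)) + y / 3 * f₁ (a + y)
        + y / 6 * f₁ a - y ^ 2 / 12 * f₂ (a + y))) (fun y => ?_) (by simp) third hx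
    refine HasDerivAt.congr_deriv ((((pow_deriv 4 y).const_mul M).div_const 144).sub
      ((((s0 y).const_sub (f a)).const_mul (1 / 2)).add
        (((hasDerivAt_id y).div_const 3).mul (s1 y)) |>.add
        (((hasDerivAt_id y).div_const 6).mul_const (f₁ a)) |>.sub
        (((pow_deriv 2 y).div_const 12).mul (s2 y)))) ?_
    simp only [id]
    push_cast
    ring
  have first : 0 ≤ M * h ^ 5 / 720 - (h / 2 * (f a + f (a + h)) - (F (a + h) - F a)
      - h ^ 2 / 12 * (f₁ (a + h) - f₁ a)) := by
    refine nonneg_of_hasDerivAt_nonneg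
      (φ := fun y => M * y ^ 5 / 720 - (y / 2 * (f a + f (a + y)) - (F (a + y) - F a)
      - y ^ 2 / 12 * (f₁ (a + y) - f₁ a))) (fun y => ?_) (by simp) second hh
    refine HasDerivAt.congr_deriv ((((pow_deriv 5 y).const_mul M).div_const 720).sub
      ((((hasDerivAt_id y).div_const 2).mul ((s0 y).const_add (f a))).sub
        ((sF y).sub_const (F a)) |>.sub
        (((pow_deriv 2 y).div_const 12).mul ((s1 y).sub_const (f₁ a))))) ?_
    simp only [id]
    push_cast
    ring
  linarith

theorem abs_corrected_trapezoid_le {F f f₁ f₂ f₃ f₄ : ℝ → ℝ} {M : ℝ}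
    (hF : ∀ x, HasDerivAt F (f x) x) (hf : ∀ x, HasDerivAt f (f₁ x) x)
    (hf₁ : ∀ x, HasDerivAt f₁ (f₂ x) x) (hf₂ : ∀ x, HasDerivAt f₂ (f₃ x) x)
    (hf₃ : ∀ x, HasDerivAt f₃ (f₄ x) x) (hM : ∀ x, |f₄ x| ≤ M) (a : ℝ) {h : ℝ} (hh : 0 ≤ h) :
    |h / 2 * (f a + f (a + h)) - (F (a + h) - F a) - h ^ 2 / 12 * (f₁ (a + h) - f₁ a)|
      ≤ M * h ^ 5 / 720 := by
  have upper := corrected_trapezoid_le hF hf hf₁ hf₂ hf₃ (fun x => (abs_le.1 (hM x)).1) a hh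
  -- The error is linear in f, so the bound for -f is the other side.
  have lower := corrected_trapezoid_le (fun x => (hF x).neg) (fun x => (hf x).neg)
    (fun x => (hf₁ x).neg) (fun x => (hf₂ x).neg) (fun x => (hf₃ x).neg)
    (fun x => neg_le_neg (abs_le.1 (hM x)).2) a hh
  simp only [Pi.neg_apply] at lower
  exact abs_le.2 ⟨by linarith, upper⟩

/-- Euler–Maclaurin error bound for the trapezoidal sum on `[0,1]` of a function with equal
boundary values, for which it agrees with the left Riemann sum. -/
theorem abs_leftRiemannSum_sub_le {F f f₁ f₂ f₃ f₄ : ℝ → ℝ} {M : ℝ}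
    (hF : ∀ x, HasDerivAt F (f x) x) (hf : ∀ x, HasDerivAt f (f₁ x) x)
    (hf₁ : ∀ x, HasDerivAt f₁ (f₂ x) x) (hf₂ : ∀ x, HasDerivAt f₂ (f₃ x) x)
    (hf₃ : ∀ x, HasDerivAt f₃ (f₄ x) x) (hM : ∀ x, |f₄ x| ≤ M) (hper : f 0 = f 1)
    {n : ℕ} (hn : 1 ≤ n) :
    |leftRiemannSum f n - (F 1 - F 0) - (f₁ 1 - f₁ 0) / (12 * (n : ℝ) ^ 2)|
      ≤ M / (720 * (n : ℝ) ^ 4) := by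
  have hn0 : (n : ℝ) ≠ 0 := by positivity
  have tele (g : ℝ → ℝ) :
      ∑ k ∈ Finset.range n, (g ((k : ℝ) / n + 1 / n) - g ((k : ℝ) / n)) = g 1 - g 0 := by
    have := Finset.sum_range_sub (fun k : ℕ => g ((k : ℝ) / n)) n
    simpa [add_div, div_self hn0] using this
  have hsum : ∑ k ∈ Finset.range n, (1 / (n : ℝ) / 2 * (f ((k : ℝ) / n) + f ((k : ℝ) / n + 1 / n))
      - (F ((k : ℝ) / n + 1 / n) - F ((k : ℝ) / n))
      - (1 / (n : ℝ)) ^ 2 / 12 * (f₁ ((k : ℝ) / n + 1 / n) - f₁ ((k : ℝ) / n)))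
      = leftRiemannSum f n - (F 1 - F 0) - (f₁ 1 - f₁ 0) / (12 * (n : ℝ) ^ 2) := by
    -- Equal boundary values turn the trapezoidal sum into the left sum.
    have hshift : ∑ k ∈ Finset.range n, f ((k : ℝ) / n + 1 / n)
        = ∑ k ∈ Finset.range n, f ((k : ℝ) / n) := by
      rw [← sub_eq_zero, ← Finset.sum_sub_distrib, tele f, hper, sub_self]
    rw [Finset.sum_sub_distrib, Finset.sum_sub_distrib, ← Finset.mul_sum, ← Finset.mul_sum,
      tele F, tele f₁, Finset.sum_add_distrib, hshift, leftRiemannSum]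
    field_simp
    ring
  rw [← hsum]
  refine (Finset.abs_sum_le_sum_abs _ _).trans ((Finset.sum_le_sum fun k _ =>
    abs_corrected_trapezoid_le hF hf hf₁ hf₂ hf₃ hM _ (by positivity)).trans (le_of_eq ?_))
  rw [Finset.sum_const, Finset.card_range, nsmul_eq_mul]
  field_simp

theorem leftRiemannSum_eq_rightRiemannSum {f : ℝ → ℝ} (hper : f 0 = f 1) {n : ℕ} (hn : 1 ≤ n) :
    leftRiemannSum f n = rightRiemannSum f n := by
  have hn0 : (n : ℝ) ≠ 0 := by positivity
  have h := Finset.sum_range_sub (fun k : ℕ => f ((k : ℝ) / n)) n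
  rw [Finset.sum_sub_distrib] at h
  simp only [div_self hn0, Nat.cast_zero, zero_div, hper, sub_self] at h
  rw [leftRiemannSum, rightRiemannSum, ← sub_eq_zero.1 h, Finset.range_eq_Ico,
    Finset.sum_Ico_add' (fun k : ℕ => f ((k : ℝ) / n)) 0 n 1]
  rfl

theorem one_sub_add_sq_pos (x : ℝ) : 0 < 1 - x + x ^ 2 := by
  nlinarith [sq_nonneg (2 * x - 1)]

theorem hasDerivAt_one_sub_add_sq (x : ℝ) :
    HasDerivAt (fun y : ℝ => 1 - y + y ^ 2) (2 * x - 1) x := by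
  refine HasDerivAt.congr_deriv (((hasDerivAt_id x).const_sub 1).add (hasDerivAt_pow 2 x)) ?_
  norm_num
  ring

theorem hasDerivAt_inv_one_sub_add_sq_pow (n : ℕ) (x : ℝ) :
    HasDerivAt (fun y : ℝ => ((1 - y + y ^ 2)⁻¹) ^ n)
      (-n * (2 * x - 1) * ((1 - x + x ^ 2)⁻¹) ^ (n + 1)) x := by
  have hD := (one_sub_add_sq_pos x).ne'
  refine HasDerivAt.congr_deriv (((hasDerivAt_one_sub_add_sq x).inv hD).pow n) ?_
  rcases n with _ | n
  · simp
  · simp only [Nat.add_sub_cancel, Pi.inv_apply, inv_pow]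
    field_simp
    ring

theorem hasDerivAt_fb_one (x : ℝ) :
    HasDerivAt (fb 1) ((1 - 2 * x) * ((1 - x + x ^ 2)⁻¹) ^ 2) x := by
  have hfb : fb 1 = fun y : ℝ => ((1 - y + y ^ 2)⁻¹) ^ 1 := by
    ext y
    simp [fb]
  rw [hfb]
  refine (hasDerivAt_inv_one_sub_add_sq_pow 1 x).congr_deriv ?_
  push_cast
  ring

/-- With t = 1/(1 - x + x²), the identity (1 - 2x)² = 4/t - 3 makes the even-order derivatives
polynomials in t alone. -/
theorem hasDerivAt_deriv_fb_one (x : ℝ) :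
    HasDerivAt (fun y : ℝ => (1 - 2 * y) * ((1 - y + y ^ 2)⁻¹) ^ 2)
      (6 * ((1 - x + x ^ 2)⁻¹) ^ 2 - 6 * ((1 - x + x ^ 2)⁻¹) ^ 3) x := by
  refine HasDerivAt.congr_deriv ((((hasDerivAt_id x).const_mul 2).const_sub 1).mul
    (hasDerivAt_inv_one_sub_add_sq_pow 2 x)) ?_
  have hD := (one_sub_add_sq_pos x).ne'
  simp only [id, inv_pow]
  push_cast
  field_simp
  ring

theorem hasDerivAt_deriv2_fb_one (x : ℝ) :
    HasDerivAt (fun y : ℝ => 6 * ((1 - y + y ^ 2)⁻¹) ^ 2 - 6 * ((1 - y + y ^ 2)⁻¹) ^ 3)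
      ((1 - 2 * x) * (12 * ((1 - x + x ^ 2)⁻¹) ^ 3 - 18 * ((1 - x + x ^ 2)⁻¹) ^ 4)) x := by
  refine HasDerivAt.congr_deriv (((hasDerivAt_inv_one_sub_add_sq_pow 2 x).const_mul 6).sub
    ((hasDerivAt_inv_one_sub_add_sq_pow 3 x).const_mul 6)) ?_
  push_cast
  ring

theorem hasDerivAt_deriv3_fb_one (x : ℝ) :
    HasDerivAt (fun y : ℝ => (1 - 2 * y) *
        (12 * ((1 - y + y ^ 2)⁻¹) ^ 3 - 18 * ((1 - y + y ^ 2)⁻¹) ^ 4))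
      (120 * ((1 - x + x ^ 2)⁻¹) ^ 3 - 360 * ((1 - x + x ^ 2)⁻¹) ^ 4
        + 216 * ((1 - x + x ^ 2)⁻¹) ^ 5) x := by
  refine HasDerivAt.congr_deriv ((((hasDerivAt_id x).const_mul 2).const_sub 1).mul
    (((hasDerivAt_inv_one_sub_add_sq_pow 3 x).const_mul 12).sub
      ((hasDerivAt_inv_one_sub_add_sq_pow 4 x).const_mul 18))) ?_
  have hD := (one_sub_add_sq_pos x).ne'
  simp only [id, inv_pow]
  push_cast
  field_simp
  ring

/-- Here t = 1/(1 - x + x²) ranges in (0, 4/3], and 512/9 is the value at t = 4/3, that is, x = 1/2.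
-/
theorem abs_deriv4_fb_one_le (x : ℝ) :
    |120 * ((1 - x + x ^ 2)⁻¹) ^ 3 - 360 * ((1 - x + x ^ 2)⁻¹) ^ 4
        + 216 * ((1 - x + x ^ 2)⁻¹) ^ 5| ≤ 512 / 9 := by
  have hD := one_sub_add_sq_pos x
  have ht0 : 0 < (1 - x + x ^ 2)⁻¹ := inv_pos.2 hD
  have ht1 : (1 - x + x ^ 2)⁻¹ ≤ 4 / 3 := by
    rw [inv_le_comm₀ hD (by norm_num)]
    nlinarith [sq_nonneg (2 * x - 1)]
  generalize (1 - x + x ^ 2)⁻¹ = t at ht0 ht1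
  have hfac : 120 * t ^ 3 - 360 * t ^ 4 + 216 * t ^ 5
      = t ^ 3 * (120 - 360 * t + 216 * t ^ 2) := by ring
  have hcube : t ^ 3 ≤ 64 / 27 := by
    calc t ^ 3 ≤ (4 / 3) ^ 3 := by gcongr
      _ = 64 / 27 := by norm_num
  have hcube0 : 0 < t ^ 3 := by positivity
  rw [hfac, abs_le]
  constructor
  · nlinarith [mul_nonneg hcube0.le (sq_nonneg (6 * t - 5))]
  -- The quadratic factor minus 24 is 216(t - 1/3)(t - 4/3), nonpositive on [1/3, 4/3]; below 1/3
  -- the cube is tiny.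
  · rcases le_total t (1 / 3) with h | h
    · have hsmall : t ^ 3 ≤ 1 / 27 := by
        calc t ^ 3 ≤ (1 / 3) ^ 3 := by gcongr
          _ = 1 / 27 := by norm_num
      have hquad : 120 - 360 * t + 216 * t ^ 2 ≤ 120 := by nlinarith
      nlinarith [mul_le_mul_of_nonneg_left hquad hcube0.le]
    · have hquad : 120 - 360 * t + 216 * t ^ 2 ≤ 24 := by nlinarith
      nlinarith [mul_le_mul_of_nonneg_left hquad hcube0.le]

theorem continuous_fb_one : Continuous (fb 1) :=
  continuous_iff_continuousAt.2 fun x => (hasDerivAt_fb_one x).continuousAt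

theorem fb_one_zero_eq_fb_one_one : fb 1 0 = fb 1 1 := by norm_num [fb]

/-- The left sums approach the integral from below, like `-1 / (6 n²)`. -/
theorem abs_leftRiemannSum_fb_one_le {n : ℕ} (hn : 1 ≤ n) :
    |leftRiemannSum (fb 1) n - (∫ x in (0 : ℝ)..1, fb 1 x) + 1 / (6 * (n : ℝ) ^ 2)|
      ≤ 32 / (405 * (n : ℝ) ^ 4) := by
  have hn0 : (n : ℝ) ≠ 0 := by positivity
  have h := abs_leftRiemannSum_sub_le (F := fun y => ∫ x in (0 : ℝ)..y, fb 1 x)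
    (fun x => intervalIntegral.integral_hasDerivAt_right
      (continuous_fb_one.intervalIntegrable _ _)
      continuous_fb_one.stronglyMeasurable.stronglyMeasurableAtFilter
      continuous_fb_one.continuousAt)
    hasDerivAt_fb_one hasDerivAt_deriv_fb_one hasDerivAt_deriv2_fb_one hasDerivAt_deriv3_fb_one
    abs_deriv4_fb_one_le fb_one_zero_eq_fb_one_one hn
  rw [intervalIntegral.integral_same] at h
  convert h using 1
  -- The boundary term is f'(1) - f'(0) = -2, whence -2/12 = -1/6.
  · congr 1
    norm_num
    field_simp
    ring
  -- (512/9)/720 = 32/405.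
  · field_simp
    norm_num

theorem leftRiemannSum_fb_one_le_succ {n : ℕ} (hn : 1 ≤ n) :
    leftRiemannSum (fb 1) n ≤ leftRiemannSum (fb 1) (n + 1) := by
  have h₁ := (abs_le.1 (abs_leftRiemannSum_fb_one_le hn)).2
  have h₂ := (abs_le.1 (abs_leftRiemannSum_fb_one_le (n := n + 1) (by omega))).1
  push_cast at h₂
  have hx : (1 : ℝ) ≤ n := by exact_mod_cast hn
  generalize (n : ℝ) = x at *
  have key : 32 / (405 * x ^ 4) + 32 / (405 * (x + 1) ^ 4)
      ≤ 1 / (6 * x ^ 2) - 1 / (6 * (x + 1) ^ 2) := by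
    rw [← sub_nonneg]
    have hx0 : 0 < x := by linarith
    have : 1 / (6 * x ^ 2) - 1 / (6 * (x + 1) ^ 2)
        - (32 / (405 * x ^ 4) + 32 / (405 * (x + 1) ^ 4))
        = (135 * (2 * x + 1) * x ^ 2 * (x + 1) ^ 2 - 64 * ((x + 1) ^ 4 + x ^ 4))
          / (810 * x ^ 4 * (x + 1) ^ 4) := by
      field_simp
      ring
    rw [this]
    refine div_nonneg ?_ (by positivity)
    -- Expanded around x = 1, the numerator has only positive coefficients.
    obtain ⟨y, hy, rfl⟩ : ∃ y, 0 ≤ y ∧ x = y + 1 := ⟨x - 1, by linarith, by ring⟩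
    ring_nf
    positivity
  linarith

theorem leftRiemannSum_fb_one_mono {m n : ℕ} (hm : 1 ≤ m) (hmn : m ≤ n) :
    leftRiemannSum (fb 1) m ≤ leftRiemannSum (fb 1) n := by
  induction n, hmn using Nat.le_induction with
  | base => exact le_rfl
  | succ k hk ih => exact ih.trans (leftRiemannSum_fb_one_le_succ (hm.trans hk))

theorem theorem3 :
    (∀ n : ℕ, 1 ≤ n → leftRiemannSum (fb 1) n = rightRiemannSum (fb 1) n) ∧
    (∀ m n : ℕ, 1 ≤ m → m ≤ n → leftRiemannSum (fb 1) m ≤ leftRiemannSum (fb 1) n) ∧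
    (∀ m n : ℕ, 1 ≤ m → m ≤ n → rightRiemannSum (fb 1) m ≤ rightRiemannSum (fb 1) n) := by
  have heq {n : ℕ} (hn : 1 ≤ n) : leftRiemannSum (fb 1) n = rightRiemannSum (fb 1) n :=
    leftRiemannSum_eq_rightRiemannSum fb_one_zero_eq_fb_one_one hn
  refine ⟨fun n hn => heq hn, fun m n hm hmn => leftRiemannSum_fb_one_mono hm hmn,
    fun m n hm hmn => ?_⟩
  rw [← heq hm, ← heq (hm.trans hmn)]
  exact leftRiemannSum_fb_one_mono hm hmn
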